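/- Let $Q_k$ and $Q_m$ be two $GI/GI/\infty$ queues: for $q\in\{k,m\}$, the inter-arrival times $X_q(1),X_q(2),\dots$ are i.i.d. nonnegative random variables, the service times $T_q(1),T_q(2),\dots$ are i.i.d. nonnegative random variables, and the two sequences are independent of each other (the two queues may be defined on different probability spaces). Customer $1$ arrives at time $Y_q(1)=0$ to an empty queue, customer $i$ arrives at time $Y_q(i)=\sum_{j=1}^{i-1}X_q(j)$ and departs at time $D_q(i)=Y_q(i)+T_q(i)$. The busy period starting at time $0$ lasts until the first time $\tau_q=\inf\{s\ge 0:\text{ no } i \text{ satisfies } Y_q(i)\le s<D_q(i)\}\in[0,\infty]$ at which the queue is empty again, and its size $B_q=\#\{i\ge 1: Y_q(i)\le\tau_q\}\in\{1,2,\dots\}\cup\{\infty\}$ is the number of arrivals in it. For random variables $Z_1,Z_2$ with values in an ordered set, write $Z_1\overset{st}{\ge}Z_2$ (equivalently $Z_2\overset{st}{\le}Z_1$) if $\mathbb E[\phi(Z_1)]\ge\mathbb E[\phi(Z_2)]$ for all increasing (that is, nondecreasing) real-valued functions $\phi$ for which both expectations exist and are finite. If $X_k(1)\overset{st}{\le}X_m(1)$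 and $T_k(1)\overset{st}{\ge}T_m(1)$, then $B_k$ and $B_m$ are random variables with $$B_k\overset{st}{\ge}B_m .$$ -/

import Mathlib

open MeasureTheory ProbabilityTheory

/-- The usual stochastic order: the random variable `Z` (under `μ`) is stochastically dominant
with respect to the random variable `W` (under `ν`), i.e. `E[φ(Z)] ≥ E[φ(W)]` for all increasing
`φ` for which the expectations exist. The two variables may live on different probability
spaces. -/
structure StochDominates {Ω₁ Ω₂ α : Type*} [MeasurableSpace Ω₁] [MeasurableSpace Ω₂]
    [MeasurableSpace α] [Preorder α]
    (μ : Measure Ω₁) (Z : Ω₁ → α) (ν : Measure Ω₂) (W : Ω₂ → α) : Prop where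
  aemeasurable_left : AEMeasurable Z μ
  aemeasurable_right : AEMeasurable W ν
  integral_le : ∀ φ : α → ℝ, Monotone φ →
    Integrable (fun ω => φ (Z ω)) μ → Integrable (fun ω => φ (W ω)) ν →
    ∫ ω, φ (W ω) ∂ν ≤ ∫ ω, φ (Z ω) ∂μ

/-- The primitive data of a `GI/GI/∞` queue on the probability space `(Ω, μ)`: i.i.d. nonnegative
inter-arrival times `X 0, X 1, …` and i.i.d. nonnegative service times `T 0, T 1, …`, the two
sequences being independent of each other. `T i` is the service time of customer `i`, and `X i`
is the time between the arrivals of customers `i` and `i + 1`. -/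
structure IsGIGIInfinityQueue {Ω : Type*} [MeasurableSpace Ω] (μ : Measure Ω)
    (X T : ℕ → Ω → ℝ) : Prop where
  measurable_arrival : ∀ i, Measurable (X i)
  measurable_service : ∀ i, Measurable (T i)
  arrival_nonneg : ∀ i, ∀ᵐ ω ∂μ, 0 ≤ X i ω
  service_nonneg : ∀ i, ∀ᵐ ω ∂μ, 0 ≤ T i ω
  identDistrib_arrival : ∀ i, IdentDistrib (X i) (X 0) μ μ
  identDistrib_service : ∀ i, IdentDistrib (T i) (T 0) μ μ
  indep : iIndepFun (fun i : ℕ ⊕ ℕ => Sum.elim X T i) μ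

namespace InfiniteServerQueue

/-- The arrival time of customer `i`, given the inter-arrival times `x`. The clock starts when
customer `0` arrives to an empty queue. -/
noncomputable def arrivalTime (x : ℕ → ℝ) (i : ℕ) : ℝ := ∑ j ∈ Finset.range i, x j

/-- The departure time of customer `i`. There are infinitely many servers, so the service of a
customer starts on arrival. -/
noncomputable def departureTime (x t : ℕ → ℝ) (i : ℕ) : ℝ := arrivalTime x i + t i

/-- The number of customers in the system at time `s`. -/
noncomputable def numberInSystem (x t : ℕ → ℝ) (s : ℝ) : ℕ∞ :=
  {i : ℕ | arrivalTime x i ≤ s ∧ s < departureTime x t i}.encard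

/-- The end of the busy period that starts at time `0`: the first time at which the system is
empty again (`⊤` if this never happens). -/
noncomputable def busyPeriodEnd (x t : ℕ → ℝ) : EReal :=
  sInf ((fun s : ℝ => (s : EReal)) '' {s : ℝ | 0 ≤ s ∧ numberInSystem x t s = 0})

/-- The size of the busy period: the number of arrivals in it, possibly infinite. A customer who
arrives at the very instant at which the last customer present leaves still belongs to the busy
period. -/
noncomputable def busyPeriodSize (x t : ℕ → ℝ) : ℕ∞ :=
  {i : ℕ | (arrivalTime x i : EReal) ≤ busyPeriodEnd x t}.encard

end InfiniteServerQueue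

/-! Drive both queues by the same independent uniform variables, passed through the quantile
functions of the respective laws. Stochastic order becomes pointwise order: queue `k` has shorter
inter-arrival times and longer services. The busy period reaches customer `n` iff each `i + 1 ≤ n`
arrives no later than some `j ≤ i` departs, that is, `x j + ... + x i ≤ t j`. This is preserved by
decreasing `x` and increasing `t` (`connectedCustomers_subset`), so the sizes are ordered pathwise.
-/

namespace ProbabilityTheory

open Set Filter Topology

/-- The uniform distribution on the open unit interval, as a measure on `ℝ`. -/
noncomputable def unitUniform : Measure ℝ := volume.restrict (Ioo 0 1)

instance : IsProbabilityMeasure unitUniform := ⟨by simp [unitUniform]⟩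

open Classical in
/-- The quantile function of a measure on the real line, extended by `0` outside `(0, 1)`. -/
noncomputable def quantile (μ : Measure ℝ) (u : ℝ) : ℝ :=
  if u ∈ Ioo (0 : ℝ) 1 then sInf {x | u ≤ cdf μ x} else 0

lemma nonempty_setOf_le_cdf (μ : Measure ℝ) {u : ℝ} (hu : u < 1) : {x | u ≤ cdf μ x}.Nonempty :=
  ((tendsto_cdf_atTop μ).eventually (lt_mem_nhds hu)).exists.imp fun _ h => h.le

lemma bddBelow_setOf_le_cdf (μ : Measure ℝ) {u : ℝ} (hu : 0 < u) :
    BddBelow {x | u ≤ cdf μ x} := by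
  obtain ⟨a, ha⟩ := ((tendsto_cdf_atBot μ).eventually (gt_mem_nhds hu)).exists
  refine ⟨a, fun x hx => ?_⟩
  by_contra! h
  exact (ha.trans_le hx).not_ge (monotone_cdf μ h.le)

lemma quantile_le_iff (μ : Measure ℝ) {u : ℝ} (hu : u ∈ Ioo (0 : ℝ) 1) (x : ℝ) :
    quantile μ u ≤ x ↔ u ≤ cdf μ x := by
  rw [quantile, if_pos hu]
  refine ⟨fun h => le_trans ?_ (monotone_cdf μ h),
    fun h => csInf_le (bddBelow_setOf_le_cdf μ hu.1) h⟩
  by_contra! hlt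
  set a := sInf {x | u ≤ cdf μ x}
  -- Right continuity makes the infimum attained.
  have hcont : Tendsto (cdf μ) (𝓝[>] a) (𝓝 (cdf μ a)) :=
    ((cdf μ).right_continuous a).mono_left (nhdsWithin_mono a Ioi_subset_Ici_self)
  obtain ⟨y, hy, hay⟩ :=
    ((hcont.eventually (gt_mem_nhds hlt)).and self_mem_nhdsWithin).exists
  refine (not_le_of_gt (mem_Ioi.1 hay)) (le_csInf (nonempty_setOf_le_cdf μ hu.2) fun z hz => ?_)
  by_contra! hzy
  exact (hy.trans_le hz).not_ge (monotone_cdf μ hzy.le)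

lemma measurable_quantile (μ : Measure ℝ) : Measurable (quantile μ) := by
  refine measurable_of_Iic fun x => ?_
  have : quantile μ ⁻¹' Iic x = (Ioo 0 1 ∩ Iic (cdf μ x)) ∪ ((Ioo 0 1)ᶜ ∩ {_u | 0 ≤ x}) := by
    ext u
    by_cases hu : u ∈ Ioo (0 : ℝ) 1
    · simp only [mem_preimage, mem_Iic, quantile_le_iff μ hu, mem_union, mem_inter_iff, hu,
        mem_compl_iff, true_and, not_true, false_and, or_false]
    · simp only [mem_preimage, mem_Iic, quantile, mem_union, mem_inter_iff, hu, if_false,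
        mem_compl_iff, not_false_iff, true_and, false_and, false_or, mem_ofPred_eq]
  rw [this]
  exact (measurableSet_Ioo.inter measurableSet_Iic).union
    (measurableSet_Ioo.compl.inter (MeasurableSet.const _))

lemma map_quantile_unitUniform (μ : Measure ℝ) [IsProbabilityMeasure μ] :
    unitUniform.map (quantile μ) = μ := by
  refine Measure.ext_of_Iic _ _ fun x => ?_
  rw [Measure.map_apply (measurable_quantile μ) measurableSet_Iic, unitUniform,
    Measure.restrict_apply (measurable_quantile μ measurableSet_Iic), ← ofReal_cdf]
  have : quantile μ ⁻¹' Iic x ∩ Ioo 0 1 = Ioo 0 1 ∩ Iic (cdf μ x) := by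
    ext u
    simp only [mem_inter_iff, mem_preimage, mem_Iic, and_comm (b := u ∈ Ioo (0 : ℝ) 1)]
    exact and_congr_right fun hu => quantile_le_iff μ hu x
  rw [this]
  refine le_antisymm ?_ ?_
  · calc volume (Ioo 0 1 ∩ Iic (cdf μ x)) ≤ volume (Icc 0 (cdf μ x)) :=
          measure_mono fun u hu => ⟨hu.1.1.le, hu.2⟩
      _ = ENNReal.ofReal (cdf μ x) := by simp
  · calc ENNReal.ofReal (cdf μ x) = volume (Ioo 0 (cdf μ x)) := by simp
      _ ≤ volume (Ioo 0 1 ∩ Iic (cdf μ x)) :=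
          measure_mono fun u hu => ⟨⟨hu.1, hu.2.trans_le (cdf_le_one μ x)⟩, hu.2.le⟩

lemma quantile_mono {μ ν : Measure ℝ} (h : ∀ x, cdf ν x ≤ cdf μ x) (u : ℝ) :
    quantile μ u ≤ quantile ν u := by
  by_cases hu : u ∈ Ioo (0 : ℝ) 1
  · rw [quantile_le_iff μ hu]
    exact ((quantile_le_iff ν hu _).1 le_rfl).trans (h _)
  · rw [quantile, quantile, if_neg hu, if_neg hu]

/-- Independent real random variables are jointly distributed as the quantile functions of their
laws applied to independent uniform random variables. -/
lemma iIndepFun.map_eq_map_quantile {Ω ι : Type*} [MeasurableSpace Ω] {μ : Measure Ω}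
    [IsProbabilityMeasure μ] {Z : ι → Ω → ℝ} (hZ : ∀ i, Measurable (Z i)) (h : iIndepFun Z μ) :
    μ.map (fun ω i => Z i ω) =
      (Measure.infinitePi fun _ : ι => unitUniform).map (fun u i => quantile (μ.map (Z i)) (u i)) := by
  have _ i : IsProbabilityMeasure (μ.map (Z i)) :=
    Measure.isProbabilityMeasure_map (hZ i).aemeasurable
  rw [h.map_fun_eq_infinitePi_map hZ,
    Measure.infinitePi_map_pi (μ := fun _ : ι => unitUniform) fun i => measurable_quantile _]
  simp_rw [map_quantile_unitUniform]

end ProbabilityTheory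

/-- Stochastic dominance of real random variables is pointwise dominance of quantiles. -/
lemma StochDominates.quantile_le {Ω₁ Ω₂ : Type*} [MeasurableSpace Ω₁] [MeasurableSpace Ω₂]
    {μ : Measure Ω₁} [IsProbabilityMeasure μ] {ν : Measure Ω₂} [IsProbabilityMeasure ν]
    {Z : Ω₁ → ℝ} {W : Ω₂ → ℝ} (h : StochDominates μ Z ν W) (u : ℝ) :
    quantile (ν.map W) u ≤ quantile (μ.map Z) u := by
  have hZ := h.aemeasurable_left
  have hW := h.aemeasurable_right
  have _ := Measure.isProbabilityMeasure_map hZ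
  have _ := Measure.isProbabilityMeasure_map hW
  refine quantile_mono (fun x => ?_) u
  -- Testing against this indicator compares the tails, hence the cdfs in reverse.
  let φ : ℝ → ℝ := (Set.Ioi x).indicator 1
  have hφ : Monotone φ := by
    intro a b hab
    by_cases ha : x < a
    · simp [φ, ha, ha.trans_le hab]
    · rw [show φ a = 0 from Set.indicator_of_notMem ha _]
      exact Set.indicator_nonneg (fun _ _ => zero_le_one) b
  have hint : ∀ (ρ : Measure ℝ) [IsProbabilityMeasure ρ], Integrable φ ρ := fun ρ _ =>
    (integrable_const (1 : ℝ)).indicator measurableSet_Ioi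
  have hval : ∀ (ρ : Measure ℝ) [IsProbabilityMeasure ρ], ∫ y, φ y ∂ρ = 1 - cdf ρ x := fun ρ _ => by
    rw [integral_indicator_one measurableSet_Ioi, cdf_eq_real, ← Set.compl_Iic,
      probReal_compl_eq_one_sub measurableSet_Iic]
  have := h.integral_le φ hφ ((hint (μ.map Z)).comp_aemeasurable hZ)
    ((hint (ν.map W)).comp_aemeasurable hW)
  rw [← integral_map hW (hint _).aestronglyMeasurable,
    ← integral_map hZ (hint _).aestronglyMeasurable, hval, hval] at this
  linarith

namespace InfiniteServerQueue

lemma arrivalTime_mono {x : ℕ → ℝ} (hx : ∀ i, 0 ≤ x i) : Monotone (arrivalTime x) :=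
  monotone_nat_of_le_succ fun n => by
    simpa [arrivalTime, Finset.sum_range_succ] using hx n

/-- The customers such that every customer after the first one and up to them finds a customer
in the system or just leaving upon arrival. -/
def connectedCustomers (x t : ℕ → ℝ) : Set ℕ :=
  {n | ∀ i < n, ∃ j ≤ i, arrivalTime x (i + 1) ≤ departureTime x t j}

lemma mem_connectedCustomers_iff {x t : ℕ → ℝ} (hx : ∀ i, 0 ≤ x i) (ht : ∀ i, 0 ≤ t i) (n : ℕ) :
    n ∈ connectedCustomers x t ↔ (arrivalTime x n : EReal) ≤ busyPeriodEnd x t := by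
  have hmono := arrivalTime_mono hx
  constructor
  · refine fun hn => le_sInf ?_
    rintro _ ⟨s, ⟨hs, hempty⟩, rfl⟩
    rw [EReal.coe_le_coe_iff]
    by_contra! hlt
    rw [numberInSystem, Set.encard_eq_zero] at hempty
    classical
    -- The customer `j` that connects the first arrival after `s` to its predecessors is still
    -- present at `s`.
    have hex : ∃ k, s < arrivalTime x k := ⟨n, hlt⟩
    have hk := Nat.find_spec hex
    have hkn : Nat.find hex ≤ n := Nat.find_min' hex hlt
    obtain ⟨i, hi⟩ : ∃ i, Nat.find hex = i + 1 := by
      refine Nat.exists_eq_succ_of_ne_zero fun h0 => ?_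
      rw [h0] at hk
      simp [arrivalTime] at hk
      linarith
    rw [hi] at hk hkn
    have his : arrivalTime x i ≤ s := not_lt.1 (Nat.find_min hex (by omega))
    obtain ⟨j, hj, hle⟩ := hn i (by omega)
    exact hempty.le (⟨(hmono hj).trans his, hk.trans_le hle⟩ :
      j ∈ {i | arrivalTime x i ≤ s ∧ s < departureTime x t i})
  · intro hn i hi
    by_contra! hlt
    -- At the last departure among customers `0, ..., i` the system is empty, since `i + 1` has not
    -- yet arrived.
    obtain ⟨m, hm, hmax⟩ := (Finset.range (i + 1)).exists_max_image (departureTime x t) ⟨0, by simp⟩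
    rw [Finset.mem_range] at hm
    have hmlt := hlt m (by omega)
    have hle : busyPeriodEnd x t ≤ (departureTime x t m : EReal) := by
      refine sInf_le ⟨_, ⟨?_, ?_⟩, rfl⟩
      · exact add_nonneg (Finset.sum_nonneg fun _ _ => hx _) (ht m)
      · rw [numberInSystem, Set.encard_eq_zero, Set.eq_empty_iff_forall_notMem]
        rintro j ⟨hj, hj'⟩
        by_cases hji : j < i + 1
        · exact (hmax j (Finset.mem_range.2 hji)).not_gt hj'
        · exact (hj.trans_lt hmlt).not_ge (hmono (not_lt.1 hji))
    have := EReal.coe_le_coe_iff.1 (hn.trans hle)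
    exact (this.trans_lt hmlt).not_ge (hmono (by omega))

lemma busyPeriodSize_eq_encard {x t : ℕ → ℝ} (hx : ∀ i, 0 ≤ x i) (ht : ∀ i, 0 ≤ t i) :
    busyPeriodSize x t = (connectedCustomers x t).encard := by
  rw [busyPeriodSize]
  congr 1
  ext n
  exact (mem_connectedCustomers_iff hx ht n).symm

/-- The arrival time of `j` cancels from both sides, leaving only a sum of inter-arrival times
against `t j`. -/
lemma connectedCustomers_subset {x x' t t' : ℕ → ℝ} (hx : ∀ i, x' i ≤ x i) (ht : ∀ i, t i ≤ t' i) :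
    connectedCustomers x t ⊆ connectedCustomers x' t' := by
  intro n hn i hi
  obtain ⟨j, hj, h⟩ := hn i hi
  refine ⟨j, hj, ?_⟩
  have hsum : ∀ y : ℕ → ℝ, arrivalTime y (i + 1) =
      arrivalTime y j + ∑ l ∈ Finset.Ico j (i + 1), y l := fun y =>
    (Finset.sum_range_add_sum_Ico y (by omega : j ≤ i + 1)).symm
  rw [departureTime, hsum, add_le_add_iff_left] at h ⊢
  exact (Finset.sum_le_sum fun l _ => hx l).trans (h.trans (ht j))

/-- The number of connected customers, as a function of the family of all inter-arrival and
service times. -/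
noncomputable def connectedSize (z : ℕ ⊕ ℕ → ℝ) : ℕ∞ :=
  (connectedCustomers (fun i => z (.inl i)) (fun i => z (.inr i))).encard

lemma measurable_connectedSize : Measurable connectedSize := by
  refine measurable_encard.comp (measurable_set_iff.2 fun n => measurableSet_setOfPred.1 ?_)
  simp only [connectedCustomers, departureTime, arrivalTime, Set.mem_ofPred_eq]
  refine measurableSet_setOfPred.2 (Measurable.forall fun i => Measurable.imp measurable_const ?_)
  refine Measurable.exists fun j => Measurable.and measurable_const ?_
  exact measurableSet_setOfPred.1 (measurableSet_le (by fun_prop) (by fun_prop))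

end InfiniteServerQueue

namespace IsGIGIInfinityQueue

open InfiniteServerQueue

variable {Ω : Type*} [MeasurableSpace Ω] {μ : Measure Ω} {X T : ℕ → Ω → ℝ}

lemma measurable_elim (h : IsGIGIInfinityQueue μ X T) (i : ℕ ⊕ ℕ) : Measurable (Sum.elim X T i) :=
  i.rec h.measurable_arrival h.measurable_service

/-- Times are nonnegative only almost surely; `connectedSize` supplies a measurable version of the
size. -/
lemma busyPeriodSize_ae_eq (h : IsGIGIInfinityQueue μ X T) :
    (fun ω => busyPeriodSize (fun i => X i ω) (fun i => T i ω)) =ᵐ[μ]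
      fun ω => connectedSize fun i => Sum.elim X T i ω := by
  filter_upwards [ae_all_iff.2 h.arrival_nonneg, ae_all_iff.2 h.service_nonneg] with ω hx ht
  exact busyPeriodSize_eq_encard hx ht

lemma aemeasurable_busyPeriodSize (h : IsGIGIInfinityQueue μ X T) :
    AEMeasurable (fun ω => busyPeriodSize (fun i => X i ω) (fun i => T i ω)) μ :=
  (measurable_connectedSize.comp (measurable_pi_lambda _ h.measurable_elim)).aemeasurable.congr
    h.busyPeriodSize_ae_eq.symm

/-- The inter-arrival and service times as functions of independent uniform random variables. -/
noncomputable def coupling (μ : Measure Ω) (X T : ℕ → Ω → ℝ) (u : ℕ ⊕ ℕ → ℝ) (i : ℕ ⊕ ℕ) : ℝ :=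
  quantile (μ.map (Sum.elim (fun _ => X 0) (fun _ => T 0) i)) (u i)

lemma measurable_coupling (μ : Measure Ω) (X T : ℕ → Ω → ℝ) : Measurable (coupling μ X T) :=
  measurable_pi_lambda _ fun i => (measurable_quantile _).comp (measurable_pi_apply i)

lemma identDistrib_coupling [IsProbabilityMeasure μ] (h : IsGIGIInfinityQueue μ X T) :
    IdentDistrib (fun ω i => Sum.elim X T i ω) (coupling μ X T) μ
      (Measure.infinitePi fun _ : ℕ ⊕ ℕ => unitUniform) where
  aemeasurable_fst := (measurable_pi_lambda _ h.measurable_elim).aemeasurable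
  aemeasurable_snd := (measurable_coupling μ X T).aemeasurable
  map_eq := by
    rw [iIndepFun.map_eq_map_quantile h.measurable_elim h.indep]
    congr 1
    ext u i
    rcases i with i | i
    · simp [coupling, (h.identDistrib_arrival i).map_eq]
    · simp [coupling, (h.identDistrib_service i).map_eq]

lemma identDistrib_busyPeriodSize [IsProbabilityMeasure μ] (h : IsGIGIInfinityQueue μ X T) :
    IdentDistrib (fun ω => busyPeriodSize (fun i => X i ω) (fun i => T i ω))
      (fun u => connectedSize (coupling μ X T u)) μ
      (Measure.infinitePi fun _ : ℕ ⊕ ℕ => unitUniform) :=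
  (IdentDistrib.of_ae_eq h.aemeasurable_busyPeriodSize h.busyPeriodSize_ae_eq).trans
    (h.identDistrib_coupling.comp measurable_connectedSize)

end IsGIGIInfinityQueue

theorem mainTheorem3
    {Ωk Ωm : Type*} [MeasurableSpace Ωk] [MeasurableSpace Ωm]
    (μk : Measure Ωk) [IsProbabilityMeasure μk]
    (μm : Measure Ωm) [IsProbabilityMeasure μm]
    (Xk Tk : ℕ → Ωk → ℝ) (Xm Tm : ℕ → Ωm → ℝ)
    (hk : IsGIGIInfinityQueue μk Xk Tk) (hm : IsGIGIInfinityQueue μm Xm Tm)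
    (hX : StochDominates μm (Xm 0) μk (Xk 0))
    (hT : StochDominates μk (Tk 0) μm (Tm 0)) :
    StochDominates
      μk (fun ω => InfiniteServerQueue.busyPeriodSize (fun i => Xk i ω) (fun i => Tk i ω))
      μm (fun ω => InfiniteServerQueue.busyPeriodSize (fun i => Xm i ω) (fun i => Tm i ω)) := by
  refine ⟨hk.aemeasurable_busyPeriodSize, hm.aemeasurable_busyPeriodSize, fun φ hφ hik him => ?_⟩
  -- `ℕ∞` is countable and discrete, so any `φ` transfers to the coupling.
  have hφm : Measurable φ := .of_discrete
  have hdk := hk.identDistrib_busyPeriodSize.comp hφm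
  have hdm := hm.identDistrib_busyPeriodSize.comp hφm
  refine (hdm.integral_eq.trans_le ?_).trans hdk.integral_eq.ge
  refine integral_mono (hdm.integrable_iff.1 him) (hdk.integrable_iff.1 hik) fun u => hφ ?_
  exact Set.encard_le_encard (InfiniteServerQueue.connectedCustomers_subset
    (fun _ => hX.quantile_le _) (fun _ => hT.quantile_le _))
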